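/- Let $L$ be a Lie ring, i.e. a Lie algebra over $\mathbb Z$. Define its lower central series by $\gamma_1(L)=L$ and $\gamma_{n+1}(L)=[L,\gamma_n(L)]$, the additive subgroup generated by all $[x,y]$ with $x\in L$, $y\in\gamma_n(L)$. Let $U(L)$ be the universal enveloping algebra of $L$ over $\mathbb Z$, $\iota\colon L\to U(L)$ the canonical map, $\varpi(L)$ the augmentation ideal of $U(L)$, i.e. the two-sided ideal generated by $\iota(L)$, and for $n\ge1$ let $\delta_n(L)=\{x\in L:\iota(x)\in\varpi(L)^n\}$, the $n$-th Lie dimension subring of $L$. Then $\gamma_4(L)\subseteq\delta_4(L)$ and $$2\,\delta_4(L)\subseteq\gamma_4(L),$$ i.e. $2x\in\gamma_4(L)$ for every $x\in\delta_4(L)$. Consequently the exponent of the fourth dimension quotient $\delta_4(L)/\gamma_4(L)$ divides $2$. -/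

import Mathlib

namespace LieDim

attribute [local instance 100] LieRing.ofAssociativeRing

/-- The augmentation ideal `ϖ(L)` of the universal enveloping algebra `U(L)`: the two-sided ideal
generated by the image of `ι : L → U(L)`. -/
def augTwoSided (K L : Type*) [CommRing K] [LieRing L] [LieAlgebra K L] :
    TwoSidedIdeal (UniversalEnvelopingAlgebra K L) :=
  TwoSidedIdeal.span (Set.range
    (UniversalEnvelopingAlgebra.ι K : L → UniversalEnvelopingAlgebra K L))

/-- The augmentation ideal `ϖ(L)`, regarded as an `Ideal` in order to speak of its powers
`ϖ(L) ^ n` (additively generated by the products of `n` elements of `ϖ(L)`). -/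
def aug (K L : Type*) [CommRing K] [LieRing L] [LieAlgebra K L] :
    Ideal (UniversalEnvelopingAlgebra K L) :=
  TwoSidedIdeal.asIdeal (augTwoSided K L)

instance aug_isTwoSided (K L : Type*) [CommRing K] [LieRing L] [LieAlgebra K L] :
    (aug K L).IsTwoSided :=
  ⟨fun b ha => by
    rw [aug, TwoSidedIdeal.mem_asIdeal] at *
    exact TwoSidedIdeal.mul_mem_right _ _ _ ha⟩

/-- The lower central series of `L`, numbered so that `γ₁(L) = L` and
`γₙ₊₁(L) = [L, γₙ(L)]` for `n ≥ 1` (and `γ₀(L) = L` by convention). -/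
def gamma (K L : Type*) [CommRing K] [LieRing L] [LieAlgebra K L] (n : ℕ) : LieIdeal K L :=
  LieModule.lowerCentralSeries K L L (n - 1)

/-- The dimension series `δₙ(L) = L ∩ ϖ(L)ⁿ`, that is, the set of all `x ∈ L` with
`ι(x) ∈ ϖ(L)ⁿ`; it is a Lie ideal of `L`. -/
def delta (K L : Type*) [CommRing K] [LieRing L] [LieAlgebra K L] (n : ℕ) : LieIdeal K L where
  carrier := {x | UniversalEnvelopingAlgebra.ι K x ∈ aug K L ^ n}
  zero_mem' := by
    change UniversalEnvelopingAlgebra.ι K (0 : L) ∈ aug K L ^ n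
    rw [map_zero]
    exact zero_mem _
  add_mem' := by
    intro x y hx hy
    change UniversalEnvelopingAlgebra.ι K (x + y) ∈ aug K L ^ n
    rw [map_add]
    exact add_mem hx hy
  smul_mem' := by
    intro c x hx
    change UniversalEnvelopingAlgebra.ι K (c • x) ∈ aug K L ^ n
    rw [map_smul, Algebra.smul_def]
    exact Ideal.mul_mem_left _ _ hx
  lie_mem := by
    intro x y hy
    change UniversalEnvelopingAlgebra.ι K ⁅x, y⁆ ∈ aug K L ^ n
    change UniversalEnvelopingAlgebra.ι K y ∈ aug K L ^ n at hy
    rw [LieHom.map_lie, LieRing.of_associative_ring_bracket]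
    exact sub_mem (Ideal.mul_mem_left _ _ hy) (Ideal.mul_mem_right _ _ hy)

/-- The `n`th dimension quotient `δₙ(L) / γₙ(L)`; the ideal divided out is the set of all elements
of `δₙ(L)` that lie in `γₙ(L)`. -/
abbrev DimQuotient (K L : Type*) [CommRing K] [LieRing L] [LieAlgebra K L] (n : ℕ) : Type _ :=
  delta K L n ⧸ LieIdeal.comap (delta K L n).incl (gamma K L n)

end LieDim

/-! The inclusion of `gamma` in `delta` is an induction: a commutator with an element of ϖⁿ lies in
ϖⁿ⁺¹. For the converse up to a factor 2, duality is used. Characters into the circle separate the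
points of L/γ₄, so it is enough that 2ψ kills δ₄ for every circle-valued ψ on L killing γ₄. This
holds once 2ψ extends to a functional on U(L) that vanishes on ϖ⁴ (`apply_eq_zero_of_mem_delta`,
`exists_truncatedFunctional`). Such a functional is given on words in L, compatibly with xy - yx =
⁅x, y⁆ and zero beyond length 3. Its value is 2ψ on letters and ψ⁅x, y⁆ on words xy;
antisymmetrising the latter gives 2ψ⁅x, y⁆, which is where the 2 comes from. On words of length 3 a
trilinear map on L/γ₂ is needed whose antisymmetrisations are prescribed by c(x, y, z) = ψ⁅⁅x, y⁆,
z⁆. For finitely generated groups it is found by sorting triples of generators, the Jacobi identity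
making the different sortings agree; compactness of the circle gives the general case
(`exists_isResolution`). -/

namespace LieDim

attribute [local instance 100] LieRing.ofAssociativeRing

/-! ### Coordinates on finitely generated abelian groups -/

/-- A finitely generated abelian group has finitely many generators `e i`, of order dividing `d i`,
and integer coordinates with respect to them that are additive modulo the `d i`. -/
theorem exists_cyclic_coordinates (M : Type*) [AddCommGroup M] [AddGroup.FG M] :
    ∃ (ι : Type) (_ : Fintype ι) (_ : LinearOrder ι) (e : ι → M) (d : ι → ℤ) (r : M → ι → ℤ),
      (∀ i, d i • e i = 0) ∧ (∀ x, x = ∑ i, r x i • e i) ∧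
      ∀ x y i, d i ∣ r (x + y) i - (r x i + r y i) := by
  classical
  obtain ⟨n, ι, hι, p, -, k, ⟨g⟩⟩ := AddCommGroup.equiv_free_prod_directSum_zmod M
  obtain ⟨hlin, -⟩ := exists_wellFoundedLT (Fin n ⊕ ι)
  refine ⟨Fin n ⊕ ι, inferInstance, hlin,
    Sum.elim (fun i => g.symm (Finsupp.single i 1, 0))
      (fun i => g.symm (0, DirectSum.of (fun i : ι => ZMod (p i ^ k i)) i 1)),
    -- Free generators get `d i = 0`, so that congruence modulo `d i` is equality there.
    Sum.elim (fun _ => 0) (fun i => (p i ^ k i : ℕ)),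
    fun x => Sum.elim (fun i => (g x).1 i) (fun i => ((g x).2 i).cast), ?_, ?_, ?_⟩
  · rintro (i | i)
    · simp
    · simp only [Sum.elim_inr, ← map_zsmul, Prod.smul_mk, smul_zero]
      have h : ((p i ^ k i : ℕ) : ℤ) • (1 : ZMod (p i ^ k i)) = 0 := by
        rw [zsmul_eq_mul, Int.cast_natCast, ZMod.natCast_self, zero_mul]
      rw [h, map_zero]
      exact map_zero g.symm
  · intro x
    apply g.injective
    rw [map_sum, Fintype.sum_sum_type]
    simp only [Sum.elim_inl, Sum.elim_inr, map_zsmul, AddEquiv.apply_symm_apply, Prod.smul_mk,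
      smul_zero]
    apply Prod.ext
    · rw [Prod.fst_add, Prod.fst_sum, Prod.fst_sum]
      ext i
      simp
    · rw [Prod.snd_add, Prod.snd_sum, Prod.snd_sum]
      simp only [Finset.sum_const_zero, zero_add, ← map_zsmul]
      have h : ∀ i, ((g x).2 i).cast • (1 : ZMod (p i ^ k i)) = (g x).2 i := fun i => by
        rw [zsmul_eq_mul, mul_one, ZMod.intCast_zmod_cast]
      simp only [h]
      exact (DirectSum.sum_univ_of _).symm
  · rintro x y (i | i)
    · simp
    · simp only [Sum.elim_inr]
      rw [← ZMod.intCast_eq_intCast_iff_dvd_sub]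
      simp

/-! ### Triadditive maps with prescribed antisymmetrisations -/

/-- A map of three variables that is additive in each of them. -/
structure IsTriadditive {M T : Type*} [AddCommGroup M] [AddCommGroup T]
    (F : M → M → M → T) : Prop where
  add_left : ∀ x x' y z, F (x + x') y z = F x y z + F x' y z
  add_mid : ∀ x y y' z, F x (y + y') z = F x y z + F x y' z
  add_right : ∀ x y z z', F x y (z + z') = F x y z + F x y z'

namespace IsTriadditive

variable {M T : Type*} [AddCommGroup M] [AddCommGroup T] {F : M → M → M → T}

theorem map_sum_left (hF : IsTriadditive F) {ι : Type*} (s : Finset ι) (a : ι → ℤ) (e : ι → M)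
    (y z : M) : F (∑ i ∈ s, a i • e i) y z = ∑ i ∈ s, a i • F (e i) y z := by
  simpa only [map_zsmul, AddMonoidHom.mk'_apply] using map_sum (AddMonoidHom.mk' (fun x => F x y z) fun x x' => hF.add_left x x' y z)
    (fun i => a i • e i) s

theorem map_sum_mid (hF : IsTriadditive F) {ι : Type*} (s : Finset ι) (a : ι → ℤ) (e : ι → M)
    (x z : M) : F x (∑ i ∈ s, a i • e i) z = ∑ i ∈ s, a i • F x (e i) z := by
  simpa only [map_zsmul, AddMonoidHom.mk'_apply] using map_sum (AddMonoidHom.mk' (fun y => F x y z) fun y y' => hF.add_mid x y y' z)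
    (fun i => a i • e i) s

theorem map_sum_right (hF : IsTriadditive F) {ι : Type*} (s : Finset ι) (a : ι → ℤ) (e : ι → M)
    (x y : M) : F x y (∑ i ∈ s, a i • e i) = ∑ i ∈ s, a i • F x y (e i) := by
  simpa only [map_zsmul, AddMonoidHom.mk'_apply] using map_sum (AddMonoidHom.mk' (fun z => F x y z) fun z z' => hF.add_right x y z z')
    (fun i => a i • e i) s

theorem zsmul_left (hF : IsTriadditive F) (n : ℤ) (x y z : M) : F (n • x) y z = n • F x y z := by
  simpa using hF.map_sum_left {()} (fun _ => n) (fun _ => x) y z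

theorem zsmul_mid (hF : IsTriadditive F) (n : ℤ) (x y z : M) : F x (n • y) z = n • F x y z := by
  simpa using hF.map_sum_mid {()} (fun _ => n) (fun _ => y) x z

theorem zsmul_right (hF : IsTriadditive F) (n : ℤ) (x y z : M) : F x y (n • z) = n • F x y z := by
  simpa using hF.map_sum_right {()} (fun _ => n) (fun _ => z) x y

theorem zero_left (hF : IsTriadditive F) (y z : M) : F 0 y z = 0 := by
  simpa using hF.zsmul_left 0 0 y z

theorem zero_mid (hF : IsTriadditive F) (x z : M) : F x 0 z = 0 := by
  simpa using hF.zsmul_mid 0 x 0 z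

theorem zero_right (hF : IsTriadditive F) (x y : M) : F x y 0 = 0 := by
  simpa using hF.zsmul_right 0 x y 0

end IsTriadditive

/-- A triadditive map with the symmetries of `⁅⁅x, y⁆, z⁆`. -/
structure IsLieTriadditive {M T : Type*} [AddCommGroup M] [AddCommGroup T]
    (c : M → M → M → T) : Prop extends IsTriadditive c where
  self : ∀ x z, c x x z = 0
  jacobi : ∀ x y z, c x y z + c y z x + c z x y = 0

theorem IsLieTriadditive.antisymm {M T : Type*} [AddCommGroup M] [AddCommGroup T]
    {c : M → M → M → T} (hc : IsLieTriadditive c) (x y z : M) : c y x z = -c x y z := by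
  have h := hc.self (x + y) z
  rw [hc.add_left, hc.add_mid, hc.add_mid, hc.self, hc.self, zero_add, add_zero] at h
  exact eq_neg_of_add_eq_zero_right h

/-- The antisymmetrisation relations that tie `F x y z` to a map `c x y z`, where `F` and `c` are
thought of as functionals of `x y z` and of `⁅⁅x, y⁆, z⁆`. -/
structure IsResolution {M T : Type*} [AddCommGroup M] [AddCommGroup T]
    (c F : M → M → M → T) : Prop extends IsTriadditive F where
  swap_left : ∀ x y z, F x y z - F y x z = c x y z
  swap_right : ∀ x y z, F x y z - F x z y = -c y z x

/-- The solution of the antisymmetrisation relations on a linearly ordered set of generators that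
vanishes on weakly increasing triples. -/
def sortedResolution {ι T : Type*} [LinearOrder ι] [AddCommGroup T] (C : ι → ι → ι → T)
    (i j k : ι) : T :=
  if i ≤ j then
    if j ≤ k then 0 else if i ≤ k then -C j k i else C i j k
  else
    if i ≤ k then C i j k else if j ≤ k then -C j k i else 0

/-- Sorting a triple by adjacent swaps, each contributing its `C` term, gives its value. The two
ways of reversing a triple of distinct indices agree by the Jacobi identity `h2`. -/
theorem sortedResolution_swap_left {ι T : Type*} [LinearOrder ι] [AddCommGroup T]
    {C : ι → ι → ι → T} (h0 : ∀ i k, C i i k = 0) (h1 : ∀ i j k, C j i k = -C i j k)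
    (h2 : ∀ i j k, C i j k + C j k i + C k i j = 0) (i j k : ι) :
    sortedResolution C i j k - sortedResolution C j i k = C i j k := by
  have h3 := h2 i j k
  have h4 := h1 i j k
  have h5 := h1 i k j
  have h6 := h1 j k i
  rcases eq_or_ne i j with rfl | hij
  · rw [h0, sub_self]
  rcases eq_or_ne i k with rfl | hik
  · have := h0 i j
    grind [sortedResolution]
  rcases eq_or_ne j k with rfl | hjk
  · have := h0 j i
    grind [sortedResolution]
  grind [sortedResolution]

theorem sortedResolution_swap_right {ι T : Type*} [LinearOrder ι] [AddCommGroup T]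
    {C : ι → ι → ι → T} (h0 : ∀ i k, C i i k = 0) (h1 : ∀ i j k, C j i k = -C i j k)
    (h2 : ∀ i j k, C i j k + C j k i + C k i j = 0) (i j k : ι) :
    sortedResolution C i j k - sortedResolution C i k j = -C j k i := by
  have h3 := h2 i j k
  have h4 := h1 i j k
  have h5 := h1 i k j
  have h6 := h1 j k i
  rcases eq_or_ne j k with rfl | hjk
  · rw [h0, sub_self, neg_zero]
  rcases eq_or_ne i k with rfl | hik
  · have := h0 i j
    grind [sortedResolution]
  rcases eq_or_ne i j with rfl | hij
  · rcases hik.lt_or_gt with h | h <;> simp [sortedResolution, h.le, h.not_ge, h0, h1 i k i]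
  grind [sortedResolution]

/-- The orders of all three generators must kill the value for it to extend additively from
generators to the group. -/
theorem zsmul_sortedResolution {ι T : Type*} [LinearOrder ι] [AddCommGroup T]
    {C : ι → ι → ι → T} {n : ℤ} {i j k : ι} (h : n • C i j k = 0) (h' : n • C j k i = 0) :
    n • sortedResolution C i j k = 0 := by
  unfold sortedResolution
  split_ifs <;> simp [h, h']

theorem exists_isResolution_of_fg {M T : Type*} [AddCommGroup M] [AddGroup.FG M] [AddCommGroup T]
    {c : M → M → M → T} (hc : IsLieTriadditive c) : ∃ F, IsResolution c F := by
  obtain ⟨ι, _, _, e, d, r, hd, hr, hadd⟩ := exists_cyclic_coordinates M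
  set C : ι → ι → ι → T := fun i j k => c (e i) (e j) (e k) with hC
  have h0 : ∀ i k, C i i k = 0 := fun i k => hc.self _ _
  have h1 : ∀ i j k, C j i k = -C i j k := fun i j k => hc.antisymm _ _ _
  have h2 : ∀ i j k, C i j k + C j k i + C k i j = 0 := fun i j k => hc.jacobi _ _ _
  have hC1 : ∀ i j k, d i • C i j k = 0 := fun i j k => by
    rw [hC, ← hc.zsmul_left, hd, hc.zero_left]
  have hC2 : ∀ i j k, d j • C i j k = 0 := fun i j k => by
    rw [hC, ← hc.zsmul_mid, hd, hc.zero_mid]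
  have hC3 : ∀ i j k, d k • C i j k = 0 := fun i j k => by
    rw [hC, ← hc.zsmul_right, hd, hc.zero_right]
  -- Coordinates are additive only modulo `d i`; on elements killed by `d i` this defect disappears.
  have key : ∀ (x y : M) (i : ι) (t : T), d i • t = 0 →
      r (x + y) i • t = r x i • t + r y i • t := by
    intro x y i t ht
    obtain ⟨m, hm⟩ := hadd x y i
    rw [← add_smul, ← sub_eq_zero, ← sub_smul, hm, mul_comm, mul_smul, ht, smul_zero]
  have hcsum : ∀ x y z, c x y z = ∑ i, ∑ j, ∑ k, r x i • r y j • r z k • C i j k := by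
    intro x y z
    conv_lhs => rw [hr x, hr y, hr z]
    simp only [hc.map_sum_left, hc.map_sum_mid, hc.map_sum_right, Finset.smul_sum, hC]
  have hd' : ∀ (n m : ℤ) (t : T), n • t = 0 → n • m • t = 0 := fun n m t h => by
    rw [smul_comm, h, smul_zero]
  have hS := sortedResolution_swap_left h0 h1 h2
  have hS' := sortedResolution_swap_right h0 h1 h2
  refine ⟨fun x y z => ∑ i, ∑ j, ∑ k, r x i • r y j • r z k • sortedResolution C i j k,
    ⟨?_, ?_, ?_⟩, ?_, ?_⟩
  · intro x x' y z
    simp only [← Finset.sum_add_distrib]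
    refine Finset.sum_congr rfl fun i _ => Finset.sum_congr rfl fun j _ =>
      Finset.sum_congr rfl fun k _ => key _ _ _ _ (hd' _ _ _ (hd' _ _ _ ?_))
    exact zsmul_sortedResolution (hC1 _ _ _) (hC3 _ _ _)
  · intro x y y' z
    simp only [← Finset.sum_add_distrib, ← smul_add]
    refine Finset.sum_congr rfl fun i _ => Finset.sum_congr rfl fun j _ =>
      Finset.sum_congr rfl fun k _ => congrArg _ (key _ _ _ _ (hd' _ _ _ ?_))
    exact zsmul_sortedResolution (hC2 _ _ _) (hC1 _ _ _)
  · intro x y z z'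
    simp only [← Finset.sum_add_distrib, ← smul_add]
    refine Finset.sum_congr rfl fun i _ => Finset.sum_congr rfl fun j _ =>
      Finset.sum_congr rfl fun k _ => congrArg _ (congrArg _ (key _ _ _ _ ?_))
    exact zsmul_sortedResolution (hC3 _ _ _) (hC2 _ _ _)
  · intro x y z
    rw [hcsum]
    nth_rewrite 2 [Finset.sum_comm]
    simp only [← Finset.sum_sub_distrib]
    refine Finset.sum_congr rfl fun i _ => Finset.sum_congr rfl fun j _ =>
      Finset.sum_congr rfl fun k _ => ?_
    rw [smul_comm (r y j) (r x i), ← smul_sub, ← smul_sub, ← smul_sub, hS]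
  · intro x y z
    have hcyc : c y z x = ∑ i, ∑ j, ∑ k, r x i • r y j • r z k • C j k i := by
      rw [hcsum, Finset.sum_congr rfl fun _ _ => Finset.sum_comm, Finset.sum_comm]
      refine Finset.sum_congr rfl fun i _ => Finset.sum_congr rfl fun j _ =>
        Finset.sum_congr rfl fun k _ => ?_
      rw [smul_comm (r z k), smul_comm (r y j)]
    rw [hcyc]
    simp only [← Finset.sum_neg_distrib]
    rw [← Finset.sum_sub_distrib]
    refine Finset.sum_congr rfl fun i _ => ?_
    nth_rewrite 2 [Finset.sum_comm]
    simp only [← Finset.sum_sub_distrib]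
    refine Finset.sum_congr rfl fun j _ => Finset.sum_congr rfl fun k _ => ?_
    rw [smul_comm (r z k) (r y j), ← smul_sub, ← smul_sub, ← smul_sub, hS', smul_neg, smul_neg,
      smul_neg]

/-- Compactness: the relations involving finitely many elements cut out closed subsets of a product
of copies of `T`, nonempty by the finitely generated case and directed, so all have a common point.
-/
theorem exists_isResolution {M T : Type*} [AddCommGroup M] [AddCommGroup T] [TopologicalSpace T]
    [IsTopologicalAddGroup T] [CompactSpace T] [T2Space T]
    {c : M → M → M → T} (hc : IsLieTriadditive c) : ∃ F, IsResolution c F := by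
  classical
  let t : Finset M → Set (M → M → M → T) := fun s => {F |
    ∀ x ∈ s, ∀ x' ∈ s, ∀ y ∈ s, ∀ z ∈ s,
      F (x + x') y z = F x y z + F x' y z ∧ F y (x + x') z = F y x z + F y x' z ∧
      F y z (x + x') = F y z x + F y z x' ∧ F x y z - F y x z = c x y z ∧
      F x y z - F x z y = -c y z x}
  have hclosed : ∀ s, IsClosed (t s) := by
    intro s
    simp only [t, Set.ofPred_forall, Set.ofPred_and]
    refine isClosed_biInter fun x _ => isClosed_biInter fun x' _ => isClosed_biInter fun y _ =>
      isClosed_biInter fun z _ => ?_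
    refine IsClosed.inter ?_ (IsClosed.inter ?_ (IsClosed.inter ?_ (IsClosed.inter ?_ ?_))) <;>
    exact isClosed_eq (by fun_prop) (by fun_prop)
  have hne : ∀ s, (t s).Nonempty := by
    intro s
    let N := AddSubgroup.closure (s : Set M)
    have hs : ∀ x ∈ s, x ∈ N := fun x hx => AddSubgroup.subset_closure hx
    obtain ⟨F, hF⟩ := exists_isResolution_of_fg (M := N) (c := fun x y z => c x y z)
      { add_left := fun _ _ _ _ => hc.add_left _ _ _ _
        add_mid := fun _ _ _ _ => hc.add_mid _ _ _ _
        add_right := fun _ _ _ _ => hc.add_right _ _ _ _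
        self := fun _ _ => hc.self _ _
        jacobi := fun _ _ _ => hc.jacobi _ _ _ }
    -- The relations for `s` only involve elements of `N`, so the values outside `N` are irrelevant.
    let p : M → N := fun x => if h : x ∈ N then ⟨x, h⟩ else 0
    have hp : ∀ x (h : x ∈ N), p x = ⟨x, h⟩ := fun x h => dif_pos h
    refine ⟨fun x y z => F (p x) (p y) (p z), fun x hx x' hx' y hy z hz => ?_⟩
    have hxx : p (x + x') = p x + p x' := by
      rw [hp x (hs x hx), hp x' (hs x' hx'), hp _ (add_mem (hs x hx) (hs x' hx'))]
      rfl
    have hl := hF.swap_left (p x) (p y) (p z)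
    have hr := hF.swap_right (p x) (p y) (p z)
    rw [hp x (hs x hx), hp y (hs y hy), hp z (hs z hz)] at hl hr
    simp only [hxx, hF.add_left, hF.add_mid, hF.add_right, true_and]
    rw [hp x (hs x hx), hp y (hs y hy), hp z (hs z hz)]
    exact ⟨hl, hr⟩
  have hdir : Directed (fun a b => a ⊇ b) t := by
    intro s s'
    refine ⟨s ∪ s', ?_, ?_⟩ <;>
    · intro F hF x hx x' hx' y hy z hz
      refine hF x ?_ x' ?_ y ?_ z ?_ <;> simp [*]
  obtain ⟨F, hF⟩ := IsCompact.nonempty_iInter_of_directed_nonempty_isCompact_isClosed t hdir hne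
    (fun s => (hclosed s).isCompact) hclosed
  have h : ∀ x x' y z, _ := fun x x' y z => Set.mem_iInter.1 hF {x, x', y, z} x (by simp)
    x' (by simp) y (by simp) z (by simp)
  exact ⟨F, ⟨fun x x' y z => (h x x' y z).1, fun x y y' z => (h y y' x z).2.1,
    fun x y z z' => (h z z' x y).2.2.1⟩, fun x y z => (h x x y z).2.2.2.1,
    fun x y z => (h x x y z).2.2.2.2⟩

/-! ### The augmentation ideal and its powers -/

open UniversalEnvelopingAlgebra in
theorem subalgebra_eq_top_of_range_le {K L : Type*} [CommRing K] [LieRing L] [LieAlgebra K L]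
    (B : Subalgebra K (UniversalEnvelopingAlgebra K L)) (hB : ∀ x : L, ι K x ∈ B) : B = ⊤ := by
  let f : L →ₗ⁅K⁆ B :=
    { toFun := fun x => ⟨ι K x, hB x⟩
      map_add' := fun x y => Subtype.ext (map_add _ _ _)
      map_smul' := fun c x => Subtype.ext (map_smul _ _ _)
      map_lie' := fun {x y} => Subtype.ext (LieHom.map_lie _ _ _) }
  -- By uniqueness in the universal property, the identity factors through `B`.
  have h : B.val.comp (lift K f) = AlgHom.id K _ := by
    ext x
    change ((lift K f (ι K x) : B) : UniversalEnvelopingAlgebra K L) = ι K x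
    rw [lift_ι_apply]
    rfl
  rw [eq_top_iff]
  intro u _
  have hu : (lift K f u : UniversalEnvelopingAlgebra K L) = u := DFunLike.congr_fun h u
  rw [← hu]
  exact (lift K f u).2

/-- The left ideal `J` generated by ι(L) is already two-sided: ι(y)ι(x) = ι⁅y, x⁆ + ι(x)ι(y), so the
`r` with `J r ⊆ J` form a subalgebra containing ι(L). -/
theorem aug_eq_span (K L : Type*) [CommRing K] [LieRing L] [LieAlgebra K L] :
    aug K L = Ideal.span (Set.range
      (UniversalEnvelopingAlgebra.ι K : L → UniversalEnvelopingAlgebra K L)) := by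
  set J := Ideal.span (Set.range
      (UniversalEnvelopingAlgebra.ι K : L → UniversalEnvelopingAlgebra K L)) with hJ
  have hι : ∀ x : L, UniversalEnvelopingAlgebra.ι K x ∈ J := fun x =>
    Ideal.subset_span ⟨x, rfl⟩
  let B : Subalgebra K (UniversalEnvelopingAlgebra K L) :=
    { carrier := {r | ∀ a ∈ J, a * r ∈ J}
      mul_mem' := fun {r s} hr hs a ha => by
        rw [← mul_assoc]
        exact hs _ (hr a ha)
      add_mem' := fun {r s} hr hs a ha => by
        rw [mul_add]
        exact add_mem (hr a ha) (hs a ha)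
      algebraMap_mem' := fun k a ha => by
        rw [← Algebra.commutes]
        exact J.mul_mem_left _ ha }
  have hB : B = ⊤ := by
    refine subalgebra_eq_top_of_range_le B fun x a ha => ?_
    induction ha using Submodule.span_induction with
    | mem a ha =>
      obtain ⟨y, rfl⟩ := ha
      have h := LieHom.map_lie (UniversalEnvelopingAlgebra.ι K) y x
      rw [LieRing.of_associative_ring_bracket, eq_sub_iff_add_eq] at h
      rw [← h]
      exact add_mem (hι _) (J.mul_mem_left _ (hι _))
    | zero => rw [zero_mul]; exact zero_mem _
    | add a b _ _ ha hb => rw [add_mul]; exact add_mem ha hb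
    | smul u a _ ha => rw [smul_eq_mul, mul_assoc]; exact J.mul_mem_left _ ha
  have hJ2 : J.IsTwoSided := ⟨fun {a} b ha => by
    have hb : b ∈ B := hB ▸ Algebra.mem_top
    exact hb a ha⟩
  apply le_antisymm
  · intro a ha
    have hle : augTwoSided K L ≤ J.toTwoSided := by
      rw [augTwoSided, TwoSidedIdeal.span_le]
      rintro _ ⟨x, rfl⟩
      exact Ideal.mem_toTwoSided.2 (hι x)
    exact Ideal.mem_toTwoSided.1 (hle (TwoSidedIdeal.mem_asIdeal.1 ha))
  · rw [hJ, Ideal.span_le]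
    rintro _ ⟨x, rfl⟩
    exact TwoSidedIdeal.mem_asIdeal.2 (TwoSidedIdeal.subset_span ⟨x, rfl⟩)

theorem ι_mem_aug {K L : Type*} [CommRing K] [LieRing L] [LieAlgebra K L] (x : L) :
    UniversalEnvelopingAlgebra.ι K x ∈ aug K L := by
  rw [aug_eq_span]
  exact Ideal.subset_span ⟨x, rfl⟩

theorem gamma_le_delta (K L : Type*) [CommRing K] [LieRing L] [LieAlgebra K L] (n : ℕ) :
    gamma K L (n + 1) ≤ delta K L (n + 1) := by
  rw [gamma, Nat.add_sub_cancel]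
  induction n with
  | zero =>
    intro x _
    change UniversalEnvelopingAlgebra.ι K x ∈ aug K L ^ 1
    rw [Submodule.pow_one]
    exact ι_mem_aug x
  | succ n ih =>
    rw [LieModule.lowerCentralSeries_succ, LieSubmodule.lie_le_iff]
    intro x _ y hy
    have hy' : UniversalEnvelopingAlgebra.ι K y ∈ aug K L ^ (n + 1) := ih hy
    change UniversalEnvelopingAlgebra.ι K ⁅x, y⁆ ∈ aug K L ^ (n + 1 + 1)
    rw [LieHom.map_lie, LieRing.of_associative_ring_bracket]
    refine sub_mem ?_ ?_
    · rw [Submodule.pow_succ' _ (Nat.succ_ne_zero n)]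
      exact Ideal.mul_mem_mul (ι_mem_aug x) hy'
    · rw [Submodule.pow_succ]
      exact Ideal.mul_mem_mul hy' (ι_mem_aug x)

/-- If `s` is a vector in a representation such that `aug ^ n` annihilates `x • s` for all
`x : L`, then `aug ^ (n + 1)` annihilates `s`. -/
theorem aug_pow_succ_annihilates {K L V : Type*} [CommRing K] [LieRing L] [LieAlgebra K L]
    [AddCommGroup V] [Module K V] (ρ : UniversalEnvelopingAlgebra K L →ₐ[K] Module.End K V)
    {n : ℕ} {s : V}
    (h : ∀ x : L, ∀ u ∈ aug K L ^ n, ρ u (ρ (UniversalEnvelopingAlgebra.ι K x) s) = 0) :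
    ∀ u ∈ aug K L ^ (n + 1), ρ u s = 0 := by
  intro u hu
  rw [Submodule.pow_succ] at hu
  induction hu using Submodule.mul_induction_on' with
  | mem_mul_mem a ha b hb =>
    rw [aug_eq_span] at hb
    induction hb using Submodule.span_induction generalizing a with
    | mem b hb =>
      obtain ⟨x, rfl⟩ := hb
      rw [map_mul]
      exact h x a ha
    | zero => simp
    | add b c _ _ hb hc => rw [mul_add, map_add, LinearMap.add_apply, hb a ha, hc a ha, add_zero]
    | smul v b _ hb =>
      rw [smul_eq_mul, ← mul_assoc]
      exact hb _ (Ideal.mul_mem_right _ _ ha)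
  | add a _ b _ ha hb => rw [map_add, LinearMap.add_apply, ha, hb, add_zero]

/-! ### Functionals on the enveloping algebra as a representation -/

/-- The functionals on the tensor algebra of `L` with values in `T` that vanish in degrees
above `3` and respect the relations of the enveloping algebra: the component of degree `n` sends
`x₁, …, xₙ` to the value at the product `xₙ ⋯ x₁`. -/
def truncatedFunctional (L T : Type*) [LieRing L] [AddCommGroup T] :
    Submodule ℤ (T × (L →ₗ[ℤ] T) × (L →ₗ[ℤ] L →ₗ[ℤ] T) × (L →ₗ[ℤ] L →ₗ[ℤ] L →ₗ[ℤ] T)) where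
  carrier := {F | ∀ x y, F.2.1 ⁅x, y⁆ = F.2.2.1 y x - F.2.2.1 x y ∧
    F.2.2.1 ⁅x, y⁆ = F.2.2.2 y x - F.2.2.2 x y ∧
    (∀ z, F.2.2.1 z ⁅x, y⁆ = F.2.2.2 z y x - F.2.2.2 z x y) ∧
    F.2.2.2 ⁅x, y⁆ = 0 ∧ (∀ z, F.2.2.2 z ⁅x, y⁆ = 0) ∧ ∀ z w, F.2.2.2 z w ⁅x, y⁆ = 0}
  zero_mem' := by simp
  add_mem' := by
    intro F G hF hG x y
    obtain ⟨a1, a2, a3, a4, a5, a6⟩ := hF x y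
    obtain ⟨b1, b2, b3, b4, b5, b6⟩ := hG x y
    simp only [Prod.snd_add, Prod.fst_add, LinearMap.add_apply, a1, a2, a3, a4, a5, a6,
      b1, b2, b3, b4, b5, b6, add_zero, implies_true, and_true]
    exact ⟨by abel, by abel, fun z => by abel⟩
  smul_mem' := by
    intro n F hF x y
    obtain ⟨a1, a2, a3, a4, a5, a6⟩ := hF x y
    simp only [Prod.smul_snd, Prod.smul_fst, LinearMap.smul_apply, a1, a2, a3, a4, a5, a6,
      smul_sub, smul_zero, implies_true, and_true]

/-- Right translation of the argument of a functional by an element of `L`. -/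
def translationEnd {L T : Type*} [LieRing L] [AddCommGroup T] (x : L) :
    Module.End ℤ (truncatedFunctional L T) where
  toFun F := ⟨(F.1.2.1 x, F.1.2.2.1 x, F.1.2.2.2 x, 0), fun y z => by
    obtain ⟨-, -, a3, -, a5, a6⟩ := F.2 y z
    simp only [a3, a5, a6, LinearMap.zero_apply, sub_zero, implies_true, and_true]⟩
  map_add' F G := Subtype.ext <| by
    simp only [Submodule.coe_add, Prod.fst_add, Prod.snd_add, LinearMap.add_apply,
      Prod.mk_add_mk, add_zero]
  map_smul' n F := Subtype.ext <| by
    simp only [Submodule.coe_smul, Prod.smul_fst, Prod.smul_snd, LinearMap.smul_apply,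
      Prod.smul_mk, smul_zero, RingHom.id_apply]

theorem coe_translationEnd {L T : Type*} [LieRing L] [AddCommGroup T] (x : L)
    (F : truncatedFunctional L T) :
    (translationEnd x F).1 = (F.1.2.1 x, F.1.2.2.1 x, F.1.2.2.2 x, 0) := rfl

/-- The action of `L` on functionals of its enveloping algebra by right translation of the
argument. -/
def translation (L T : Type*) [LieRing L] [AddCommGroup T] :
    L →ₗ⁅ℤ⁆ Module.End ℤ (truncatedFunctional L T) where
  toFun := translationEnd
  map_add' x y := LinearMap.ext fun F => Subtype.ext <| by
    simp only [LinearMap.add_apply, Submodule.coe_add, coe_translationEnd, map_add,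
      Prod.mk_add_mk, add_zero]
  map_smul' n x := LinearMap.ext fun F => Subtype.ext <| by
    simp only [LinearMap.smul_apply, Submodule.coe_smul, coe_translationEnd, map_smul,
      Prod.smul_mk, smul_zero, RingHom.id_apply]
  map_lie' {x y} := LinearMap.ext fun F => Subtype.ext <| by
    obtain ⟨a1, a2, -, a4, -, -⟩ := F.2 x y
    rw [LieRing.of_associative_ring_bracket]
    simp only [LinearMap.sub_apply, Module.End.mul_apply, Submodule.coe_sub, coe_translationEnd,
      a1, a2, a4, Prod.mk_sub_mk, sub_zero, LinearMap.zero_apply]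

/-- The value of `F` at ι(x) is the degree 0 part of its translate by `x`. Each translation lowers
degrees by one, so four of them kill `F`, and hence so does ϖ⁴. -/
theorem apply_eq_zero_of_mem_delta {L T : Type*} [LieRing L] [AddCommGroup T]
    (F : truncatedFunctional L T) {x : L} (hx : x ∈ delta ℤ L 4) : F.1.2.1 x = 0 := by
  let ρ := UniversalEnvelopingAlgebra.lift ℤ (translation L T)
  have hρ : ∀ y G, ρ (UniversalEnvelopingAlgebra.ι ℤ y) G = translationEnd y G := fun y G => by
    rw [UniversalEnvelopingAlgebra.lift_ι_apply]
    rfl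
  have h0 : ∀ a b c d : L, translationEnd a (translationEnd b (translationEnd c
      (translationEnd d F))) = 0 := fun a b c d => Subtype.ext <| by
    simp only [coe_translationEnd, LinearMap.zero_apply]
    rfl
  have h : ∀ u ∈ aug ℤ L ^ 4, ρ u F = 0 := by
    refine aug_pow_succ_annihilates ρ fun a => aug_pow_succ_annihilates ρ fun b =>
      aug_pow_succ_annihilates ρ fun c => aug_pow_succ_annihilates ρ fun d u _ => ?_
    rw [hρ, hρ, hρ, hρ, h0, map_zero]
  have h1 := h _ hx
  rw [hρ] at h1
  exact congrArg (fun G => G.1.1) h1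

theorem IsTriadditive.comp {M N T : Type*} [AddCommGroup M] [AddCommGroup N] [AddCommGroup T]
    {F : M → M → M → T} (hF : IsTriadditive F) (f : N →+ M) :
    IsTriadditive fun x y z => F (f x) (f y) (f z) where
  add_left x x' y z := by rw [map_add, hF.add_left]
  add_mid x y y' z := by rw [map_add, hF.add_mid]
  add_right x y z z' := by rw [map_add, hF.add_right]

/-- A triadditive map as a trilinear map over the integers. -/
def IsTriadditive.toLinearMap {M T : Type*} [AddCommGroup M] [AddCommGroup T]
    {F : M → M → M → T} (hF : IsTriadditive F) : M →ₗ[ℤ] M →ₗ[ℤ] M →ₗ[ℤ] T :=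
  LinearMap.mk₂ ℤ (fun x y => (AddMonoidHom.mk' (F x y) (hF.add_right x y)).toIntLinearMap)
    (fun x x' y => LinearMap.ext fun z => hF.add_left x x' y z)
    (fun n x y => LinearMap.ext fun z => hF.zsmul_left n x y z)
    (fun x y y' => LinearMap.ext fun z => hF.add_mid x y y' z)
    (fun n x y => LinearMap.ext fun z => hF.zsmul_mid n x y z)

/-! ### Characters and the lower central series -/

/-- Homomorphisms to the circle separate the points of an abelian group. -/
theorem exists_unitAddCircle_ne_zero {A : Type*} [AddCommGroup A] {a : A} (ha : a ≠ 0) :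
    ∃ ψ : A →+ UnitAddCircle, ψ a ≠ 0 := by
  obtain ⟨φ, hφ⟩ := CharacterModule.exists_character_apply_ne_zero_of_ne_zero ha
  -- Characters into ℚ/ℤ already separate points; embedding it in ℝ/ℤ supplies a compact target.
  let j : AddCircle (1 : ℚ) →+ UnitAddCircle :=
    QuotientAddGroup.map (AddSubgroup.zmultiples (1 : ℚ)) (AddSubgroup.zmultiples (1 : ℝ))
      (Rat.castHom ℝ).toAddMonoidHom (by
        rw [AddSubgroup.zmultiples_le]
        exact ⟨1, by simp⟩)
  have hj : ∀ q, j q = 0 → q = 0 := by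
    intro q
    induction q using QuotientAddGroup.induction_on with
    | H q =>
      intro h
      obtain ⟨n, hn⟩ := (QuotientAddGroup.eq_zero_iff (N := AddSubgroup.zmultiples (1 : ℝ)) _).1 h
      refine (QuotientAddGroup.eq_zero_iff (N := AddSubgroup.zmultiples (1 : ℚ)) _).2 ⟨n, ?_⟩
      have hn' : (n : ℝ) = (q : ℝ) := by simpa using hn
      have : (n : ℚ) = q := by exact_mod_cast hn'
      simpa using this
  exact ⟨j.comp φ, fun h => hφ (hj _ h)⟩

section gamma

variable {K L : Type*} [CommRing K] [LieRing L] [LieAlgebra K L]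

theorem lie_mem_gamma_succ {n : ℕ} {y : L} (hy : y ∈ gamma K L (n + 1)) (x : L) :
    ⁅x, y⁆ ∈ gamma K L (n + 2) := by
  change _ ∈ LieModule.lowerCentralSeries K L L (n + 1)
  rw [LieModule.lowerCentralSeries_succ]
  exact LieSubmodule.lie_mem_lie (LieSubmodule.mem_top x) hy

theorem lie_mem_gamma_succ' {n : ℕ} {y : L} (hy : y ∈ gamma K L (n + 1)) (x : L) :
    ⁅y, x⁆ ∈ gamma K L (n + 2) := by
  rw [← lie_skew]
  exact neg_mem (lie_mem_gamma_succ hy x)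

theorem lie_mem_gamma_two (x y : L) : ⁅x, y⁆ ∈ gamma K L 2 :=
  lie_mem_gamma_succ (n := 0) (LieSubmodule.mem_top (R := K) (L := L) y) x

theorem lie_lie_mem_gamma_four {z : L} (hz : z ∈ gamma K L 2) (x y : L) :
    ⁅⁅x, y⁆, z⁆ ∈ gamma K L 4 := by
  rw [lie_lie]
  exact sub_mem (lie_mem_gamma_succ (lie_mem_gamma_succ hz y) x)
    (lie_mem_gamma_succ (lie_mem_gamma_succ hz x) y)

end gamma

/-! ### Extension of the doubled functional and conclusion -/

/-- A circle-valued functional `ψ` on `L` that vanishes on `γ₄(L)` extends, after doubling, to the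
enveloping algebra. -/
theorem exists_truncatedFunctional {L T : Type*} [LieRing L] [AddCommGroup T] [TopologicalSpace T]
    [IsTopologicalAddGroup T] [CompactSpace T] [T2Space T] (ψ : L →ₗ[ℤ] T)
    (hψ : ∀ x ∈ gamma ℤ L 4, ψ x = 0) :
    ∃ F : truncatedFunctional L T, F.1.2.1 = (2 : ℤ) • ψ := by
  let N := (gamma ℤ L 2).toSubmodule.toAddSubgroup
  let π : L →+ L ⧸ N := QuotientAddGroup.mk' N
  have hπ : ∀ x y, π ⁅x, y⁆ = 0 := fun x y =>
    (QuotientAddGroup.eq_zero_iff _).2 (lie_mem_gamma_two (K := ℤ) x y)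
  -- Changing an argument by an element of γ₂ changes the triple bracket by an element of γ₄, which
  -- `ψ` kills, so the chosen representatives do not matter.
  let c : L ⧸ N → L ⧸ N → L ⧸ N → T := fun a b d => ψ ⁅⁅a.out, b.out⁆, d.out⁆
  have hout : ∀ x, ∃ n ∈ gamma ℤ L 2, (π x).out = x + n := fun x => by
    obtain ⟨n, hn⟩ := QuotientAddGroup.mk_out_eq_add N x
    exact ⟨n, n.2, hn⟩
  have hc : ∀ x y z, c (π x) (π y) (π z) = ψ ⁅⁅x, y⁆, z⁆ := by
    intro x y z
    obtain ⟨u, hu, hxu⟩ := hout x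
    obtain ⟨v, hv, hyv⟩ := hout y
    obtain ⟨w, hw, hzw⟩ := hout z
    simp only [c, hxu, hyv, hzw]
    rw [lie_add, map_add, hψ _ (lie_lie_mem_gamma_four hw _ _), add_zero, add_lie, add_lie,
      map_add, hψ _ (lie_mem_gamma_succ' (lie_mem_gamma_succ' hu _) _), add_zero, lie_add,
      add_lie, map_add, hψ _ (lie_mem_gamma_succ' (lie_mem_gamma_succ hv _) _), add_zero]
  have hsurj : Function.Surjective π := QuotientAddGroup.mk'_surjective N
  have hLie : IsLieTriadditive c :=
    { add_left := hsurj.forall.2 fun x => hsurj.forall.2 fun x' => hsurj.forall.2 fun y =>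
        hsurj.forall.2 fun z => by
          rw [← map_add π, hc, hc, hc, add_lie, add_lie, map_add]
      add_mid := hsurj.forall.2 fun x => hsurj.forall.2 fun y => hsurj.forall.2 fun y' =>
        hsurj.forall.2 fun z => by
          rw [← map_add π, hc, hc, hc, lie_add, add_lie, map_add]
      add_right := hsurj.forall.2 fun x => hsurj.forall.2 fun y => hsurj.forall.2 fun z =>
        hsurj.forall.2 fun z' => by
          rw [← map_add π, hc, hc, hc, lie_add, map_add]
      self := hsurj.forall.2 fun x => hsurj.forall.2 fun z => by
        rw [hc, lie_self, zero_lie, map_zero]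
      jacobi := hsurj.forall.2 fun x => hsurj.forall.2 fun y => hsurj.forall.2 fun z => by
        rw [hc, hc, hc, ← map_add, ← map_add, ← lie_skew ⁅x, y⁆, ← lie_skew ⁅y, z⁆,
          ← lie_skew ⁅z, x⁆, ← neg_add, ← neg_add, add_rotate, lie_jacobi, neg_zero, map_zero] }
  obtain ⟨F, hF⟩ := exists_isResolution hLie
  let F₂ : L →ₗ[ℤ] L →ₗ[ℤ] T := LinearMap.mk₂ ℤ (fun a b => ψ ⁅b, a⁆)
    (fun a a' b => by rw [lie_add, map_add]) (fun n a b => by rw [lie_zsmul, map_zsmul])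
    (fun a b b' => by rw [add_lie, map_add]) (fun n a b => by rw [zsmul_lie, map_zsmul])
  have hF₂ : ∀ a b, F₂ a b = ψ ⁅b, a⁆ := fun a b => rfl
  -- Factoring through L/γ₂ makes `F₃` vanish on brackets in every slot, as the absence of degree 4
  -- terms requires.
  let F₃ := (hF.toIsTriadditive.comp π).toLinearMap
  have hF₃ : ∀ x y z, F₃ x y z = F (π x) (π y) (π z) := fun x y z => rfl
  refine ⟨⟨(0, (2 : ℤ) • ψ, F₂, F₃), fun x y => ⟨?_, ?_, fun z => ?_, ?_, fun z => ?_,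
    fun z w => ?_⟩⟩, rfl⟩
  · change (2 : ℤ) • ψ ⁅x, y⁆ = F₂ y x - F₂ x y
    rw [hF₂, hF₂, ← lie_skew y x, map_neg, two_zsmul, sub_neg_eq_add]
  · refine LinearMap.ext fun z => ?_
    change F₂ ⁅x, y⁆ z = F₃ y x z - F₃ x y z
    rw [hF₂, hF₃, hF₃, hF.swap_left, hc, ← lie_skew, ← neg_lie, lie_skew]
  · change F₂ z ⁅x, y⁆ = F₃ z y x - F₃ z x y
    rw [hF₂, hF₃, hF₃, hF.swap_right, hc, ← map_neg, ← neg_lie, lie_skew]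
  · refine LinearMap.ext fun z => LinearMap.ext fun w => ?_
    change F₃ ⁅x, y⁆ z w = 0
    rw [hF₃, hπ, hF.zero_left]
  · refine LinearMap.ext fun w => ?_
    change F₃ z ⁅x, y⁆ w = 0
    rw [hF₃, hπ, hF.zero_mid]
  · change F₃ z w ⁅x, y⁆ = 0
    rw [hF₃, hπ, hF.zero_right]

theorem two_smul_mem_gamma_four {L : Type*} [LieRing L] {x : L} (hx : x ∈ delta ℤ L 4) :
    2 • x ∈ gamma ℤ L 4 := by
  by_contra h
  let N := (gamma ℤ L 4).toSubmodule.toAddSubgroup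
  have h' : QuotientAddGroup.mk' N (2 • x) ≠ 0 := fun h0 =>
    h ((QuotientAddGroup.eq_zero_iff _).1 h0)
  obtain ⟨ψ, hψ⟩ := exists_unitAddCircle_ne_zero h'
  obtain ⟨F, hF⟩ := exists_truncatedFunctional (ψ.comp (QuotientAddGroup.mk' N)).toIntLinearMap
    fun y hy => by
      change ψ (QuotientAddGroup.mk' N y) = 0
      have hy0 : QuotientAddGroup.mk' N y = 0 := (QuotientAddGroup.eq_zero_iff _).2 hy
      rw [hy0, map_zero]
  have h0 := apply_eq_zero_of_mem_delta F hx
  rw [hF] at h0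
  apply hψ
  rw [map_nsmul, map_nsmul, ← natCast_zsmul]
  exact h0

end LieDim

theorem mainTheorem4 (L : Type*) [LieRing L] :
    LieDim.gamma ℤ L 4 ≤ LieDim.delta ℤ L 4 ∧
    (∀ x ∈ LieDim.delta ℤ L 4, 2 • x ∈ LieDim.gamma ℤ L 4) ∧
    AddMonoid.exponent (LieDim.DimQuotient ℤ L 4) ∣ 2 := by
  refine ⟨LieDim.gamma_le_delta ℤ L 3, fun x hx => LieDim.two_smul_mem_gamma_four hx, ?_⟩
  refine AddMonoid.exponent_dvd_of_forall_nsmul_eq_zero fun q => ?_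
  obtain ⟨⟨x, hx⟩, rfl⟩ := Submodule.Quotient.mk_surjective _ q
  exact (Submodule.Quotient.mk_eq_zero _).2 (LieDim.two_smul_mem_gamma_four hx)
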